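/- Let $G=(V,E)$ be a finite directed graph (loops and multiple edges allowed) with $V=\{v_1,\dots,v_N\}$, source and terminal maps $s,t:E\to V$, such that every vertex has an incoming and an outgoing edge. Let $A^G=[A^G(e,f)]_{e,f\in E}$ be its edge matrix, $A^G(e,f)=1$ if $t(e)=s(f)$ and $A^G(e,f)=0$ otherwise. Let $\mathcal O_{A^G}$ be the Cuntz–Krieger algebra, i.e. the universal unital $C^*$-algebra generated by partial isometries $S_e$, $e\in E$, with $\sum_{f}S_fS_f^*=1$ and $S_e^*S_e=\sum_f A^G(e,f)S_fS_f^*$, and put $P_v=\sum_{f:\,s(f)=v}S_fS_f^*$ for $v\in V$. A $G$-Catalan word of length $2n$ is a word $X=(X_1,\dots,X_{2n})$ in the letters $S_e,S_e^*$ $(e\in E)$ whose product $\pi_G(X)=X_1\cdots X_{2n}$ is nonzero in $\mathcal O_{A^G}$ and whose product becomes $1$ when the letters are read as the canonical generating isometries, and their adjoints, of the Cuntz algebra $\mathcal O_{|E|}$ with generators indexed by $E$. Let $B_n^G$ be the set of these words and $B_n^G(v)=\{X\in B_n^G:\pi_G(X)=P_v\}$. Put $c_0^G(i)=1$ and $c_n^G(i)=|B_n^G(v_i)|$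 for $n\ge 1$. For a state $\varphi$ on $\mathcal O_{A^G}$ put $$c_0^{G,\varphi}(i)=\varphi(P_{v_i}),\quad c_n^{G,\varphi}(i)=\sum_{X\in B_n^G(v_i)}\varphi(\pi_G(X)),\qquad c_0^{G,\varphi}=1,\quad c_n^{G,\varphi}=\sum_{X\in B_n^G}\varphi(\pi_G(X))\qquad(n\ge1),$$ and let $f_i^G$, $f_i^{G,\varphi}$, $f^{G,\varphi}$ be the formal power series $\sum_{n\ge0}c_n^G(i)x^n$, $\sum_{n\ge0}c_n^{G,\varphi}(i)x^n$, $\sum_{n\ge0}c_n^{G,\varphi}x^n$. Suppose that $A^G$ is aperiodic, i.e. some power $(A^G)^k$, $k\ge1$, has only positive entries. Let $\varphi$ be a KMS state on $\mathcal O_{A^G}$, at some inverse temperature $\beta\in\mathbb R$, for the gauge action $\alpha_t(S_e)=e^{\sqrt{-1}\,t}S_e$ $(t\in\mathbb R)$; that is, $\varphi(\alpha_t(a)b)=\varphi(b\,\alpha_{t+\sqrt{-1}\beta}(a))$ for all $t\in\mathbb R$, all $b\in\mathcal O_{A^G}$ and all analytic $a$, i.e. those for which $t\mapsto\alpha_t(a)$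 extends to an entire function $z\mapsto\alpha_z(a)$. Let $r_G$ be the Perron–Frobenius eigenvalue (the spectral radius) of $A^G$ and let $[t_e]_{e\in E}$ be its positive eigenvector, $\sum_f A^G(e,f)t_f=r_Gt_e$, normalized by $\sum_{e\in E}t_e=1$. For each $i=1,\dots,N$ let $e_i\in E$ be any edge with $t(e_i)=v_i$. Then for all $n\ge0$ and $i=1,\dots,N$ $$c_n^{G,\varphi}(i)=r_G\,c_n^G(i)\,t_{e_i},\qquad c_n^{G,\varphi}=r_G\sum_{i=1}^N c_n^G(i)\,t_{e_i},$$ and hence $$f_i^{G,\varphi}(x)=r_G\,f_i^G(x)\,t_{e_i},\qquad f^{G,\varphi}(x)=r_G\sum_{i=1}^N f_i^G(x)\,t_{e_i}.$$ -/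

import Mathlib

open scoped ENNReal

universe u

noncomputable section

/-- A Cuntz--Krieger family for the matrix `A` in a unital C*-algebra `B`: partial isometries
`S e` with `∑ f, S f (S f)* = 1` and `(S e)* (S e) = ∑ f, A e f S f (S f)*` for every `e`. -/
structure IsCuntzKriegerFamily {ι : Type*} [Fintype ι] (A : Matrix ι ι ℕ)
    {B : Type*} [CStarAlgebra B] (S : ι → B) : Prop where
  partialIsometry : ∀ e, S e * star (S e) * S e = S e
  sum_range : ∑ f, S f * star (S f) = 1
  source_eq : ∀ e, star (S e) * S e = ∑ f, A e f • (S f * star (S f))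

/-- A partial isometry is a contraction. -/
theorem IsCuntzKriegerFamily.norm_le_one {ι : Type*} [Fintype ι] {A : Matrix ι ι ℕ}
    {B : Type*} [CStarAlgebra B] {S : ι → B} (h : IsCuntzKriegerFamily A S) (e : ι) :
    ‖S e‖ ≤ 1 := by
  have h1 : (star (S e) * S e) * (star (S e) * S e) = star (S e) * S e := by
    calc (star (S e) * S e) * (star (S e) * S e) = star (S e) * (S e * star (S e) * S e) := by
          simp only [mul_assoc]
      _ = _ := by rw [h.partialIsometry e]
  have h2 : ‖star (S e) * S e‖ * ‖star (S e) * S e‖ = ‖star (S e) * S e‖ := by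
    rw [← CStarRing.norm_star_mul_self (x := star (S e) * S e), star_mul, star_star, h1]
  rw [CStarRing.norm_star_mul_self] at h2
  have h3 := norm_nonneg (S e)
  by_contra! h4
  have h5 : 1 < ‖S e‖ * ‖S e‖ := by nlinarith
  nlinarith

/-- The value at the family `S` of a noncommutative polynomial in the symbols
`Sum.inl e` (for `(S e)*`) and `Sum.inr e` (for `S e`). -/
def starPolyEval {ι : Type*} {B : Type*} [CStarAlgebra B] (S : ι → B) :
    FreeAlgebra ℂ (ι ⊕ ι) →ₐ[ℂ] B :=
  FreeAlgebra.lift ℂ (Sum.elim (fun e => star (S e)) S)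

/-- `p` is the seminorm on noncommutative *-polynomials given by evaluation at some
Cuntz--Krieger family for `A` in some nonzero C*-algebra. -/
def IsCuntzKriegerSeminorm {ι : Type u} [Fintype ι] (A : Matrix ι ι ℕ)
    (p : FreeAlgebra ℂ (ι ⊕ ι) → ℝ) : Prop :=
  ∃ (B : Type u) (_ : CStarAlgebra B) (_ : Nontrivial B) (S : ι → B),
    IsCuntzKriegerFamily A S ∧ ∀ x, p x = ‖starPolyEval S x‖

namespace CuntzKrieger

/-- The set of all seminorms coming from Cuntz--Krieger families. -/
abbrev Index {ι : Type u} [Fintype ι] (A : Matrix ι ι ℕ) : Type u :=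
  {p : FreeAlgebra ℂ (ι ⊕ ι) → ℝ // IsCuntzKriegerSeminorm A p}

variable {ι : Type u} [Fintype ι] {A : Matrix ι ι ℕ}

/-- A C*-algebra carrying a Cuntz--Krieger family that induces the seminorm `p`. -/
def Fiber (p : Index A) : Type u := p.2.choose

instance (p : Index A) : CStarAlgebra (Fiber p) := p.2.choose_spec.choose

instance (p : Index A) : Nontrivial (Fiber p) := p.2.choose_spec.choose_spec.choose

/-- The chosen Cuntz--Krieger family inducing the seminorm `p`. -/
def fiberFamily (p : Index A) : ι → Fiber p := p.2.choose_spec.choose_spec.choose_spec.choose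

theorem fiberFamily_isCK (p : Index A) : IsCuntzKriegerFamily A (fiberFamily p) :=
  p.2.choose_spec.choose_spec.choose_spec.choose_spec.1

theorem norm_eval_fiberFamily (p : Index A) (x : FreeAlgebra ℂ (ι ⊕ ι)) :
    ‖starPolyEval (fiberFamily p) x‖ = p.1 x :=
  (p.2.choose_spec.choose_spec.choose_spec.choose_spec.2 x).symm

variable (A) in
/-- The C*-algebraic direct product of all the fibres. -/
abbrev Ambient : Type u := lp (fun p : Index A => Fiber p) ∞

instance : CStarAlgebra (Ambient A) where

variable (A) in
/-- The direct sum of all the chosen Cuntz--Krieger families. -/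
def ambientFamily (e : ι) : Ambient A :=
  ⟨fun p => fiberFamily p e, memℓp_infty ⟨1, by
    rintro _ ⟨p, rfl⟩
    exact (fiberFamily_isCK p).norm_le_one e⟩⟩

theorem ambientFamily_isCK : IsCuntzKriegerFamily A (ambientFamily A) where
  partialIsometry e := by
    ext p
    exact (fiberFamily_isCK p).partialIsometry e
  sum_range := by
    ext p
    have := (fiberFamily_isCK p).sum_range
    simp only [lp.coeFn_sum, Finset.sum_apply]
    exact this
  source_eq e := by
    ext p
    have := (fiberFamily_isCK p).source_eq e
    simp only [lp.coeFn_sum, Finset.sum_apply]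
    exact this

/-- The coordinate projection of the direct product. -/
def proj (p : Index A) : Ambient A →⋆ₐ[ℂ] Fiber p where
  toFun x := x p
  map_one' := rfl
  map_mul' _ _ := rfl
  map_zero' := rfl
  map_add' _ _ := rfl
  commutes' _ := rfl
  map_star' _ := rfl

theorem map_starPolyEval {ι : Type*} {B C : Type*} [CStarAlgebra B] [CStarAlgebra C]
    (f : B →⋆ₐ[ℂ] C) (S : ι → B) (x : FreeAlgebra ℂ (ι ⊕ ι)) :
    f (starPolyEval S x) = starPolyEval (fun e => f (S e)) x := by
  have h : (f : B →ₐ[ℂ] C).comp (starPolyEval S) = starPolyEval (fun e => f (S e)) := by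
    ext e
    rcases e with e | e <;> simp [starPolyEval, map_star]
  exact DFunLike.congr_fun h x

end CuntzKrieger

/-- The closed *-subalgebra generated by the direct sum of the Cuntz--Krieger families. -/
def cuntzKriegerSubalgebra {ι : Type u} [Fintype ι] (A : Matrix ι ι ℕ) :
    StarSubalgebra ℂ (CuntzKrieger.Ambient A) :=
  (StarAlgebra.adjoin ℂ (Set.range (CuntzKrieger.ambientFamily A))).topologicalClosure

/-- The Cuntz--Krieger algebra of the matrix `A`: the universal unital C*-algebra generated by a
Cuntz--Krieger family for `A`. It is realised as the C*-algebra generated by the direct sum of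
Cuntz--Krieger families, one for each seminorm on *-polynomials that such a family induces.
`CuntzKriegerAlgebra.isCuntzKriegerFamily_gen`, `CuntzKriegerAlgebra.lift_gen` and
`CuntzKriegerAlgebra.hom_ext` are its universal property. The universe of `ι` is large enough,
because a C*-algebra generated by finitely many elements has at most the cardinality of the
continuum. -/
def CuntzKriegerAlgebra {ι : Type u} [Fintype ι] (A : Matrix ι ι ℕ) : Type u :=
  cuntzKriegerSubalgebra A

namespace CuntzKriegerAlgebra

open CuntzKrieger

variable {ι : Type u} [Fintype ι] {A : Matrix ι ι ℕ}

instance : IsClosed (cuntzKriegerSubalgebra A : Set (Ambient A)) :=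
  StarSubalgebra.isClosed_topologicalClosure _

instance : CStarAlgebra (CuntzKriegerAlgebra A) :=
  inferInstanceAs (CStarAlgebra (cuntzKriegerSubalgebra A))

variable (A) in
/-- The canonical generators of the Cuntz--Krieger algebra. -/
def gen (e : ι) : CuntzKriegerAlgebra A :=
  ⟨ambientFamily A e, StarSubalgebra.le_topologicalClosure _
    (StarAlgebra.subset_adjoin ℂ _ ⟨e, rfl⟩)⟩

variable (A) in
/-- The inclusion of the Cuntz--Krieger algebra into the direct product. -/
def incl : CuntzKriegerAlgebra A →⋆ₐ[ℂ] Ambient A :=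
  StarSubalgebra.subtype (cuntzKriegerSubalgebra A)

theorem incl_gen (e : ι) : incl A (gen A e) = ambientFamily A e := rfl

theorem incl_injective : Function.Injective (incl A) := Subtype.val_injective

theorem isCuntzKriegerFamily_gen : IsCuntzKriegerFamily A (gen A) where
  partialIsometry e := incl_injective (ambientFamily_isCK.partialIsometry e)
  sum_range := incl_injective (by
    rw [map_sum, map_one]
    exact ambientFamily_isCK.sum_range)
  source_eq e := incl_injective (by
    rw [map_sum]
    exact ambientFamily_isCK.source_eq e)

theorem denseRange_starPolyEval_gen : DenseRange (starPolyEval (gen A)) := by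
  have h1 : (StarAlgebra.adjoin ℂ (Set.range (ambientFamily A))).toSubalgebra ≤
      (((incl A : CuntzKriegerAlgebra A →ₐ[ℂ] Ambient A)).comp (starPolyEval (gen A))).range := by
    rw [StarAlgebra.adjoin_toSubalgebra, Algebra.adjoin_le_iff]
    rintro y (⟨e, rfl⟩ | ⟨e, he⟩)
    · exact ⟨FreeAlgebra.ι ℂ (Sum.inr e), by simp [starPolyEval, incl_gen]⟩
    · refine ⟨FreeAlgebra.ι ℂ (Sum.inl e), ?_⟩
      rw [← star_star y, ← he]
      simp [starPolyEval, incl_gen, map_star]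
  have hemb : Topology.IsEmbedding (incl A) := Topology.IsEmbedding.subtypeVal
  intro x
  rw [hemb.closure_eq_preimage_closure_image]
  refine closure_mono ?_ (x.2 : incl A x ∈ closure
    (StarAlgebra.adjoin ℂ (Set.range (ambientFamily A)) : Set (Ambient A)))
  intro y hy
  obtain ⟨z, hz⟩ := h1 hy
  exact ⟨starPolyEval (gen A) z, ⟨z, rfl⟩, hz⟩

theorem norm_starPolyEval_le {B : Type u} [CStarAlgebra B] {S : ι → B}
    (hS : IsCuntzKriegerFamily A S) (x : FreeAlgebra ℂ (ι ⊕ ι)) :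
    ‖starPolyEval S x‖ ≤ ‖starPolyEval (gen A) x‖ := by
  rcases subsingleton_or_nontrivial B with h | h
  · rw [Subsingleton.elim (starPolyEval S x) 0, norm_zero]
    exact norm_nonneg _
  · let p : Index A := ⟨fun x => ‖starPolyEval S x‖, B, inferInstance, h, S, hS, fun _ => rfl⟩
    have h1 : ‖starPolyEval (fiberFamily p) x‖ = ‖starPolyEval S x‖ := norm_eval_fiberFamily p x
    have h2 : starPolyEval (fiberFamily p) x = (incl A (starPolyEval (gen A) x)) p := by
      have := map_starPolyEval ((proj p).comp (incl A)) (gen A) x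
      exact this.symm
    rw [← h1, h2]
    exact lp.norm_apply_le_norm ENNReal.top_ne_zero _ p

/-- Two continuous unital *-homomorphisms agreeing on the generators are equal. -/
theorem hom_ext {B : Type*} [CStarAlgebra B] {f g : CuntzKriegerAlgebra A →⋆ₐ[ℂ] B}
    (h : ∀ e, f (gen A e) = g (gen A e)) : f = g := by
  have hf : Continuous f := (NonUnitalStarAlgHom.instContinuousLinearMapClassComplex.toContinuousMapClass).map_continuous f
  have hg : Continuous g := (NonUnitalStarAlgHom.instContinuousLinearMapClassComplex.toContinuousMapClass).map_continuous g
  refine DFunLike.coe_injective (denseRange_starPolyEval_gen.equalizer hf hg ?_)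
  funext x
  simp only [Function.comp_apply, map_starPolyEval, h]

/-- The universal property: a Cuntz--Krieger family for `A` in a C*-algebra `B` extends to a
unital *-homomorphism. -/
def lift {B : Type u} [CStarAlgebra B] {S : ι → B} (hS : IsCuntzKriegerFamily A S) :
    CuntzKriegerAlgebra A →⋆ₐ[ℂ] B :=
  let F := (starPolyEval S).toLinearMap.extendOfNorm (starPolyEval (gen A)).toLinearMap
  have hF : ∀ x, F (starPolyEval (gen A) x) = starPolyEval S x := fun x =>
    LinearMap.extendOfNorm_eq (f := (starPolyEval S).toLinearMap)
      (e := (starPolyEval (gen A)).toLinearMap) denseRange_starPolyEval_gen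
      ⟨1, fun x => by rw [one_mul]; exact norm_starPolyEval_le hS x⟩ x
  have hF1 : F 1 = 1 := by simpa using hF 1
  have hmul : ∀ a b, F (a * b) = F a * F b := fun a b =>
    denseRange_starPolyEval_gen.induction_on₂ (p := fun a b => F (a * b) = F a * F b)
      (isClosed_eq (by fun_prop) (by fun_prop))
      (fun x y => by rw [← map_mul, hF, hF, hF, map_mul]) a b
  have hstar : ∀ a, F (star a) = star (F a) := by
    intro a
    refine denseRange_starPolyEval_gen.induction_on (p := fun a => F (star a) = star (F a)) a
      (isClosed_eq (by fun_prop) (by fun_prop)) fun x => ?_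
    induction x using FreeAlgebra.induction with
    | grade0 r =>
      rw [AlgHom.commutes, Algebra.algebraMap_eq_smul_one, star_smul, star_one, map_smul,
        map_smul, star_smul, hF1, star_one]
    | grade1 e =>
      rcases e with e | e
      · have h1 := hF (FreeAlgebra.ι ℂ (Sum.inl e))
        have h2 := hF (FreeAlgebra.ι ℂ (Sum.inr e))
        simp only [starPolyEval, FreeAlgebra.lift_ι_apply, Sum.elim_inl, Sum.elim_inr] at h1 h2 ⊢
        rw [star_star, h1, h2, star_star]
      · have h1 := hF (FreeAlgebra.ι ℂ (Sum.inl e))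
        have h2 := hF (FreeAlgebra.ι ℂ (Sum.inr e))
        simp only [starPolyEval, FreeAlgebra.lift_ι_apply, Sum.elim_inl, Sum.elim_inr] at h1 h2 ⊢
        rw [h1, h2]
    | mul x y hx hy => rw [map_mul, star_mul, hmul, hmul, hx, hy, star_mul]
    | add x y hx hy => rw [map_add, star_add, map_add, map_add, hx, hy, star_add]
  { toFun := F
    map_one' := hF1
    map_mul' := hmul
    map_zero' := map_zero F
    map_add' := map_add F
    commutes' := fun r => by
      rw [Algebra.algebraMap_eq_smul_one, map_smul, hF1, ← Algebra.algebraMap_eq_smul_one]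
    map_star' := hstar }

theorem lift_gen {B : Type u} [CStarAlgebra B] {S : ι → B} (hS : IsCuntzKriegerFamily A S)
    (e : ι) : lift hS (gen A e) = S e := by
  have h := LinearMap.extendOfNorm_eq (f := (starPolyEval S).toLinearMap)
      (e := (starPolyEval (gen A)).toLinearMap) denseRange_starPolyEval_gen
      ⟨1, fun x => by rw [one_mul]; exact norm_starPolyEval_le hS x⟩ (FreeAlgebra.ι ℂ (Sum.inr e))
  have h1 : starPolyEval (gen A) (FreeAlgebra.ι ℂ (Sum.inr e)) = gen A e := by simp [starPolyEval]
  have h2 : starPolyEval S (FreeAlgebra.ι ℂ (Sum.inr e)) = S e := by simp [starPolyEval]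
  rw [AlgHom.toLinearMap_apply, AlgHom.toLinearMap_apply, h1, h2] at h
  exact h

/-- Multiplying a Cuntz--Krieger family by a complex number of modulus one gives a
Cuntz--Krieger family. -/
theorem isCuntzKriegerFamily_circle_smul {B : Type*} [CStarAlgebra B] {S : ι → B}
    (hS : IsCuntzKriegerFamily A S) (z : Circle) :
    IsCuntzKriegerFamily A (fun e => (z : ℂ) • S e) := by
  have hz : (z : ℂ) * star (z : ℂ) = 1 := by
    rw [Complex.star_def, Complex.mul_conj, Circle.normSq_coe, Complex.ofReal_one]
  have hz' : star (z : ℂ) * (z : ℂ) = 1 := by rw [mul_comm, hz]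
  have h1 : ∀ e, ((z : ℂ) • S e) * star ((z : ℂ) • S e) = S e * star (S e) := fun e => by
    rw [star_smul, smul_mul_smul_comm, hz, one_smul]
  have h2 : ∀ e, star ((z : ℂ) • S e) * ((z : ℂ) • S e) = star (S e) * S e := fun e => by
    rw [star_smul, smul_mul_smul_comm, hz', one_smul]
  exact
    { partialIsometry := fun e => by rw [h1, mul_smul_comm, hS.partialIsometry]
      sum_range := by simp only [h1, hS.sum_range]
      source_eq := fun e => by simp only [h1, h2, hS.source_eq] }

variable (A) in
/-- The *-endomorphism `S e ↦ z (S e)`. -/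
def gaugeHom (z : Circle) : CuntzKriegerAlgebra A →⋆ₐ[ℂ] CuntzKriegerAlgebra A :=
  lift (isCuntzKriegerFamily_circle_smul isCuntzKriegerFamily_gen z)

theorem gaugeHom_gen (z : Circle) (e : ι) : gaugeHom A z (gen A e) = (z : ℂ) • gen A e :=
  lift_gen _ e

theorem gaugeHom_gaugeHom (z w : Circle) (a : CuntzKriegerAlgebra A) :
    gaugeHom A z (gaugeHom A w a) = gaugeHom A (z * w) a := by
  have h : (gaugeHom A z).comp (gaugeHom A w) = gaugeHom A (z * w) := hom_ext fun e => by
    rw [StarAlgHom.comp_apply, gaugeHom_gen, map_smul, gaugeHom_gen, gaugeHom_gen, smul_smul,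
      Circle.coe_mul, mul_comm]
  exact DFunLike.congr_fun h a

theorem gaugeHom_one (a : CuntzKriegerAlgebra A) : gaugeHom A 1 a = a := by
  have h : gaugeHom A 1 = StarAlgHom.id ℂ _ := hom_ext fun e => by
    rw [gaugeHom_gen, Circle.coe_one, one_smul]
    rfl
  exact DFunLike.congr_fun h a

variable (A) in
/-- The gauge action of the circle group on the Cuntz--Krieger algebra: the *-automorphism
determined by `S e ↦ z (S e)`. -/
def gauge (z : Circle) : CuntzKriegerAlgebra A ≃⋆ₐ[ℂ] CuntzKriegerAlgebra A :=
  StarAlgEquiv.ofStarAlgHom (gaugeHom A z) (gaugeHom A z⁻¹)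
    (StarAlgHom.ext fun a => by simp [gaugeHom_gaugeHom, gaugeHom_one])
    (StarAlgHom.ext fun a => by simp [gaugeHom_gaugeHom, gaugeHom_one])

theorem gauge_gen (z : Circle) (e : ι) : gauge A z (gen A e) = (z : ℂ) • gen A e :=
  gaugeHom_gen z e

theorem gauge_mul (z w : Circle) (a : CuntzKriegerAlgebra A) :
    gauge A (z * w) a = gauge A z (gauge A w a) :=
  (gaugeHom_gaugeHom z w a).symm

end CuntzKriegerAlgebra

/-- The Cuntz algebra with generators indexed by `ι`: the Cuntz--Krieger algebra of the matrix
all of whose entries are `1`. -/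
abbrev CuntzAlgebra (ι : Type u) [Fintype ι] : Type u :=
  CuntzKriegerAlgebra (Matrix.of fun _ _ : ι => 1)

/-- The canonical generating isometries of the Cuntz algebra. -/
abbrev CuntzAlgebra.gen {ι : Type u} [Fintype ι] : ι → CuntzAlgebra ι :=
  CuntzKriegerAlgebra.gen (Matrix.of fun _ _ : ι => 1)

/-- For the all-ones matrix, the Cuntz--Krieger relations are the Cuntz relations. -/
theorem isCuntzKriegerFamily_ones_iff {ι : Type*} [Fintype ι] {B : Type*} [CStarAlgebra B]
    {S : ι → B} : IsCuntzKriegerFamily (Matrix.of fun _ _ : ι => 1) S ↔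
      ∑ j, S j * star (S j) = 1 ∧ ∀ i, star (S i) * S i = 1 := by
  refine ⟨fun h => ⟨h.sum_range, fun i => ?_⟩, fun h => ⟨fun i => ?_, h.1, fun i => ?_⟩⟩
  · simpa [h.sum_range] using h.source_eq i
  · rw [mul_assoc, h.2, mul_one]
  · simp [h.1, h.2]

/-- A state on a unital C*-algebra: a positive linear functional of value `1` at `1`. -/
structure IsState {B : Type*} [CStarAlgebra B] (φ : B →ₗ[ℂ] ℂ) : Prop where
  nonneg : ∀ a, 0 ≤ (φ (star a * a)).re ∧ (φ (star a * a)).im = 0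
  map_one : φ 1 = 1

/-- `F` is the entire extension `z ↦ α_z(a)` of the orbit `t ↦ α_t(a)`; the elements `a` that
have such an extension are the analytic elements of the flow `α`. -/
structure IsEntireExtension {B : Type*} [CStarAlgebra B] (α : ℝ → B → B) (a : B) (F : ℂ → B) :
    Prop where
  differentiable : Differentiable ℂ F
  apply_real : ∀ t : ℝ, F t = α t a

/-- A KMS state for the flow `α` at inverse temperature `β`:
`φ(α_t(a) b) = φ(b α_{t + iβ}(a))` for all real `t`, all analytic `a` and all `b`. -/
structure IsKMSState {B : Type*} [CStarAlgebra B] (α : ℝ → B → B) (β : ℝ) (φ : B →ₗ[ℂ] ℂ) :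
    Prop where
  isState : IsState φ
  kms : ∀ (a b : B) (F : ℂ → B), IsEntireExtension α a F →
    ∀ t : ℝ, φ (α t a * b) = φ (b * F (t + β * Complex.I))

/-- The product `X₁ ⋯ X_m` of a word in the letters `Sum.inl e` (standing for `(S e)*`) and
`Sum.inr e` (standing for `S e`). -/
def wordProd {ι B : Type*} [CStarAlgebra B] (S : ι → B) {m : ℕ} (X : Fin m → ι ⊕ ι) : B :=
  (List.ofFn fun k => Sum.elim (fun e => star (S e)) S (X k)).prod

/-- A directed graph with vertex set `V` and edge set `E`; loops and multiple edges are
allowed. -/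
structure EdgeGraph (V E : Type*) where
  src : E → V
  tgt : E → V

namespace EdgeGraph

variable {V : Type*} {E : Type u} [Fintype V] [DecidableEq V] [Fintype E]

/-- The edge matrix: `A(e,f) = 1` if the terminal vertex of `e` is the source of `f`, and `0`
otherwise. -/
def edgeMatrix (G : EdgeGraph V E) (R : Type*) [Zero R] [One R] : Matrix E E R :=
  Matrix.of fun e f => if G.tgt e = G.src f then 1 else 0

/-- The Perron--Frobenius eigenvalue of the edge matrix, that is, its spectral radius. -/
def perronEigenvalue [DecidableEq E] (G : EdgeGraph V E) : ℝ :=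
  (spectralRadius ℂ (G.edgeMatrix ℂ)).toReal

/-- The Cuntz--Krieger algebra of the edge matrix of `G`. -/
abbrev CKAlgebra (G : EdgeGraph V E) : Type u := CuntzKriegerAlgebra (G.edgeMatrix ℕ)

/-- The generating partial isometry of the edge `e`. -/
abbrev S (G : EdgeGraph V E) (e : E) : G.CKAlgebra := CuntzKriegerAlgebra.gen (G.edgeMatrix ℕ) e

/-- The vertex projection `P v`, the sum of `(S f) (S f)*` over the edges `f` with source `v`. -/
def P (G : EdgeGraph V E) (v : V) : G.CKAlgebra :=
  ∑ f with G.src f = v, G.S f * star (G.S f)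

/-- The gauge action as a flow: `α_t(S e) = exp(it) (S e)`. -/
def gaugeFlow (G : EdgeGraph V E) (t : ℝ) (a : G.CKAlgebra) : G.CKAlgebra :=
  CuntzKriegerAlgebra.gauge (G.edgeMatrix ℕ) (Circle.exp t) a

open Classical in
/-- The `G`-Catalan words of length `2n`: the words whose product is nonzero in the
Cuntz--Krieger algebra of `G` and becomes `1` in the Cuntz algebra with the same index set of
generators. -/
def catalanWords (G : EdgeGraph V E) (n : ℕ) : Finset (Fin (2 * n) → E ⊕ E) :=
  {X | wordProd G.S X ≠ 0 ∧ wordProd (CuntzAlgebra.gen (ι := E)) X = 1}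

open Classical in
/-- The `G`-Catalan words rooted at `v`, that is, with product the vertex projection `P v`. -/
def catalanWordsAt (G : EdgeGraph V E) (n : ℕ) (v : V) : Finset (Fin (2 * n) → E ⊕ E) :=
  {X ∈ G.catalanWords n | wordProd G.S X = G.P v}

/-- The `G`-Catalan numbers rooted at `v`. -/
def catalanNumberAt (G : EdgeGraph V E) (n : ℕ) (v : V) : ℕ :=
  if n = 0 then 1 else (G.catalanWordsAt n v).card

/-- The `(G, φ)`-Catalan numbers rooted at `v`. -/
def stateCatalanNumberAt (G : EdgeGraph V E) (φ : G.CKAlgebra →ₗ[ℂ] ℂ) (n : ℕ) (v : V) : ℂ :=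
  if n = 0 then φ (G.P v) else ∑ X ∈ G.catalanWordsAt n v, φ (wordProd G.S X)

/-- The `(G, φ)`-Catalan numbers. -/
def stateCatalanNumber (G : EdgeGraph V E) (φ : G.CKAlgebra →ₗ[ℂ] ℂ) (n : ℕ) : ℂ :=
  if n = 0 then 1 else ∑ X ∈ G.catalanWords n, φ (wordProd G.S X)

/-- The generating function of the `G`-Catalan numbers rooted at `v`. -/
def genFunAt (G : EdgeGraph V E) (v : V) : PowerSeries ℂ :=
  PowerSeries.mk fun n => (G.catalanNumberAt n v : ℂ)

/-- The generating function of the `(G, φ)`-Catalan numbers rooted at `v`. -/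
def stateGenFunAt (G : EdgeGraph V E) (φ : G.CKAlgebra →ₗ[ℂ] ℂ) (v : V) : PowerSeries ℂ :=
  PowerSeries.mk fun n => G.stateCatalanNumberAt φ n v

/-- The generating function of the `(G, φ)`-Catalan numbers. -/
def stateGenFun (G : EdgeGraph V E) (φ : G.CKAlgebra →ₗ[ℂ] ℂ) : PowerSeries ℂ :=
  PowerSeries.mk fun n => G.stateCatalanNumber φ n

end EdgeGraph

end

/-! Every word rooted at v has product `P v`, so a rooted state count is the number of words times
φ(P v), and it remains to compute φ(P v). The KMS condition for a = S_e, b = S_e^* gives φ(S_e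
S_e^*) = e^{-β} φ(P_{t(e)}). Hence x_e = φ(S_e S_e^*) is a nonnegative vector of sum 1 with A x =
e^β x, and Perron–Frobenius uniqueness (`Matrix.IsPrimitive.eq_of_nonneg_eigenvector`) gives x = t.
Then φ(P_{t(e)}) = (A t)_e = r t_e. For the unrooted count, each Catalan word of positive length
must have exactly one root. Existence comes from reducing the word in both algebras at once
(`exists_normalForm`): the Cuntz product becomes S_μ S_ν^*, the Cuntz–Krieger product becomes 0 or
S_μ P_v S_ν^*. With at least two edges, S_μ S_ν^* = 1 forces μ and ν empty, since the Cuntz algebra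
is nonzero and its generators are not right invertible; a single edge is treated apart. Uniqueness
is orthogonality of the vertex projections. -/

section PerronFrobenius

/-! ### Perron–Frobenius uniqueness -/

variable {n : Type*} [Fintype n] {A : Matrix n n ℝ}

theorem Matrix.pow_mulVec_of_mulVec_eq_smul [DecidableEq n] {x : n → ℝ} {l : ℝ} (h : A.mulVec x = l • x) (k : ℕ) :
    (A ^ k).mulVec x = l ^ k • x := by
  induction k with
  | zero => simp
  | succ k ih => rw [pow_succ, ← Matrix.mulVec_mulVec, h, Matrix.mulVec_smul, ih, smul_smul,
      pow_succ, mul_comm]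

/-- Take c to be the largest ratio x i / t i: the multiple c • t dominates x and touches it at a
maximizing index. -/
theorem exists_le_mul_and_eq_mul [Nonempty n] {t : n → ℝ} (ht : ∀ i, 0 < t i) (x : n → ℝ) :
    ∃ c : ℝ, (∀ i, x i ≤ c * t i) ∧ ∃ i, x i = c * t i := by
  obtain ⟨i, hi⟩ := Finite.exists_max fun i => x i / t i
  exact ⟨x i / t i, fun j => (div_le_iff₀ (ht j)).1 (hi j), i, (div_mul_cancel₀ _ (ht i).ne').symm⟩

/-- Apply A to x ≤ c • t and read the result at the touching coordinate. The roles of t and x can be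
exchanged, so two positive eigenvectors have the same eigenvalue. -/
theorem Matrix.eigenvalue_le_of_pos [Nonempty n] (hA : ∀ i j, 0 ≤ A i j) {t x : n → ℝ} {r l : ℝ}
    (ht : ∀ i, 0 < t i) (hx : ∀ i, 0 < x i) (hr : A.mulVec t = r • t) (hl : A.mulVec x = l • x) :
    l ≤ r := by
  obtain ⟨c, hc, i, hi⟩ := exists_le_mul_and_eq_mul ht x
  have h : l * x i ≤ r * x i := by
    calc l * x i = (A.mulVec x) i := by rw [hl]; rfl
      _ ≤ (A.mulVec (c • t)) i :=
        Finset.sum_le_sum fun j _ => mul_le_mul_of_nonneg_left (hc j) (hA i j)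
      _ = r * x i := by
        rw [Matrix.mulVec_smul, hr, hi]
        simp only [Pi.smul_apply, smul_eq_mul]
        ring
  exact le_of_mul_le_mul_right h (hx i)

/-- The normalised positive eigenvector of a primitive matrix is its only normalised nonnegative
eigenvector. -/
theorem Matrix.IsPrimitive.eq_of_nonneg_eigenvector [DecidableEq n] (hA : A.IsPrimitive) {t x : n → ℝ} {r l : ℝ}
    (ht : ∀ i, 0 < t i) (hx : ∀ i, 0 ≤ x i) (hr : A.mulVec t = r • t) (hl : A.mulVec x = l • x)
    (ht1 : ∑ i, t i = 1) (hx1 : ∑ i, x i = 1) : x = t := by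
  obtain ⟨k, -, hk⟩ := hA.exists_pos_pow
  obtain ⟨j, -, hj⟩ : ∃ j ∈ Finset.univ, x j ≠ 0 :=
    Finset.exists_ne_zero_of_sum_ne_zero (by rw [hx1]; exact one_ne_zero)
  have : Nonempty n := ⟨j⟩
  -- A zero coordinate of x would be a zero coordinate of A^k x = l^k x, but A^k has positive
  -- entries and x ≠ 0.
  have hpos : ∀ i, 0 < x i := by
    intro i
    refine (hx i).lt_of_ne' fun h0 => ?_
    have h1 := congrFun (Matrix.pow_mulVec_of_mulVec_eq_smul hl k) i
    rw [Pi.smul_apply, h0, smul_zero] at h1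
    have h2 : 0 < ((A ^ k).mulVec x) i :=
      Finset.sum_pos' (fun m _ => mul_nonneg (hk i m).le (hx m))
        ⟨j, Finset.mem_univ j, mul_pos (hk i j) ((hx j).lt_of_ne' hj)⟩
    exact h2.ne' h1
  obtain rfl : l = r := le_antisymm (Matrix.eigenvalue_le_of_pos hA.nonneg ht hpos hr hl)
    (Matrix.eigenvalue_le_of_pos hA.nonneg hpos ht hl hr)
  obtain ⟨c, hc, i, hi⟩ := exists_le_mul_and_eq_mul ht x
  -- The nonnegative eigenvector c • t - x vanishes at i, so row i of the positive matrix A^k forces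
  -- it to vanish everywhere.
  have hy : A.mulVec (c • t - x) = l • (c • t - x) := by
    rw [Matrix.mulVec_sub, Matrix.mulVec_smul, hr, hl, smul_sub, smul_comm]
  have h1 : ((A ^ k).mulVec (c • t - x)) i = 0 := by
    rw [Matrix.pow_mulVec_of_mulVec_eq_smul hy k]
    simp [hi]
  have h2 := (Finset.sum_eq_zero_iff_of_nonneg fun m _ =>
    mul_nonneg (hk i m).le (sub_nonneg.2 (hc m))).1 h1
  have h3 : x = c • t := by
    funext m
    have := (mul_eq_zero.1 (h2 m (Finset.mem_univ m))).resolve_left (hk i m).ne'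
    exact (sub_eq_zero.1 this).symm
  have hc1 : c = 1 := by
    rw [h3] at hx1
    simpa [← Finset.mul_sum, ht1] using hx1
  rw [h3, hc1, one_smul]

end PerronFrobenius

/-! ### Orthogonality of projections with sum 1 -/

section StarProjection

variable {B : Type*} [CStarAlgebra B]

/-- Projections in a C*-algebra that add up to `1` are mutually orthogonal. -/
theorem IsStarProjection.mul_eq_zero_of_sum_eq_one {ι : Type*} [Fintype ι] {p : ι → B}
    (hp : ∀ i, IsStarProjection (p i)) (hsum : ∑ i, p i = 1) {i j : ι} (hij : i ≠ j) :
    p i * p j = 0 := by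
  classical
  let _ := CStarAlgebra.spectralOrder B
  have _ := CStarAlgebra.spectralOrderedRing B
  have h1 : ∑ k, p j * p k * p j = p j := by
    rw [← Finset.sum_mul, ← Finset.mul_sum, hsum, mul_one, (hp j).isIdempotentElem.eq]
  -- Compressing ∑ p k = 1 by p j and removing the term k = j leaves a vanishing sum of the positive
  -- elements (p k p j)^* (p k p j), so each of them is 0.
  have hsq : ∀ k, p j * p k * p j = star (p k * p j) * (p k * p j) := fun k => by
    rw [star_mul, (hp k).isSelfAdjoint.star_eq, (hp j).isSelfAdjoint.star_eq, mul_assoc, mul_assoc,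
      ← mul_assoc (p k) (p k), (hp k).isIdempotentElem.eq]
  have h2 : ∑ k ∈ Finset.univ.erase j, p j * p k * p j = 0 := by
    rw [← Finset.add_sum_erase _ _ (Finset.mem_univ j), (hp j).isIdempotentElem.eq,
      (hp j).isIdempotentElem.eq] at h1
    exact add_eq_left.1 h1
  have h3 := (Finset.sum_eq_zero_iff_of_nonneg fun k _ => by
    rw [hsq]; exact star_mul_self_nonneg _).1 h2 i (Finset.mem_erase.2 ⟨hij, Finset.mem_univ i⟩)
  rw [hsq] at h3
  exact CStarRing.star_mul_self_eq_zero_iff _ |>.1 h3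

end StarProjection

/-! ### Consequences of the Cuntz–Krieger relations -/

namespace IsCuntzKriegerFamily

variable {ι : Type*} [Fintype ι] {A : Matrix ι ι ℕ} {B : Type*} [CStarAlgebra B] {S : ι → B}

theorem isStarProjection_range (h : IsCuntzKriegerFamily A S) (e : ι) :
    IsStarProjection (S e * star (S e)) where
  isIdempotentElem := by
    rw [IsIdempotentElem, ← mul_assoc, h.partialIsometry]
  isSelfAdjoint := IsSelfAdjoint.mul_star_self _

theorem star_mul_self_mul_star (h : IsCuntzKriegerFamily A S) (e : ι) :
    star (S e) * S e * star (S e) = star (S e) := by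
  simpa [mul_assoc] using congrArg star (h.partialIsometry e)

theorem star_mul_eq_zero (h : IsCuntzKriegerFamily A S) {e f : ι} (hef : e ≠ f) :
    star (S e) * S f = 0 := by
  have h1 := IsStarProjection.mul_eq_zero_of_sum_eq_one h.isStarProjection_range h.sum_range hef
  calc star (S e) * S f
      = (star (S e) * S e * star (S e)) * (S f * star (S f) * S f) := by
        rw [h.partialIsometry, h.star_mul_self_mul_star]
    _ = star (S e) * (S e * star (S e) * (S f * star (S f))) * S f := by simp only [mul_assoc]
    _ = 0 := by rw [h1, mul_zero, zero_mul]

end IsCuntzKriegerFamily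

/-! ### A representation of the Cuntz algebra -/

section CuntzRepresentation

theorem HilbertBasis.continuousLinearMap_ext {ι 𝕜 H K : Type*} [RCLike 𝕜] [NormedAddCommGroup H]
    [InnerProductSpace 𝕜 H] [NormedAddCommGroup K] [NormedSpace 𝕜 K] (b : HilbertBasis ι 𝕜 H)
    {f g : H →L[𝕜] K} (h : ∀ i, f (b i) = g (b i)) : f = g :=
  ContinuousLinearMap.ext_on (Submodule.dense_iff_topologicalClosure_eq_top.2 b.dense_span)
    (by rintro _ ⟨i, rfl⟩; exact h i)

/-- A decomposition of an orthonormal basis into copies of itself gives Cuntz isometries. -/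
theorem HilbertBasis.exists_cuntzFamily {ι X H : Type*} [Fintype ι] [NormedAddCommGroup H]
    [InnerProductSpace ℂ H] [CompleteSpace H] (b : HilbertBasis X ℂ H) (j : ι × X ≃ X) :
    ∃ S : ι → H →L[ℂ] H, IsCuntzKriegerFamily (Matrix.of fun _ _ : ι => 1) S := by
  classical
  have hv : ∀ e, Orthonormal ℂ fun x => b (j (e, x)) := fun e =>
    b.orthonormal.comp _ fun x y hxy => (Prod.ext_iff.1 (j.injective hxy)).2
  let U : ι → H →ₗᵢ[ℂ] H := fun e =>
    (hv e).orthogonalFamily.linearIsometry.comp b.repr.toLinearIsometry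
  have hU : ∀ e x, U e (b x) = b (j (e, x)) := fun e x => by
    change (hv e).orthogonalFamily.linearIsometry (b.repr (b x)) = _
    rw [b.repr_self, OrthogonalFamily.linearIsometry_apply_single,
      LinearIsometry.toSpanSingleton_apply, one_smul]
  let S : ι → H →L[ℂ] H := fun e => (U e).toContinuousLinearMap
  have hS : ∀ e x, S e (b x) = b (j (e, x)) := hU
  -- The adjoint strips the label e from a basis vector and kills vectors with any other label.
  have hstar : ∀ e f x, star (S e) (b (j (f, x))) = if e = f then b x else 0 := fun e f x => by
    refine b.repr.injective (lp.ext (funext fun y => ?_))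
    rw [b.repr_apply_apply, b.repr_apply_apply, ContinuousLinearMap.star_eq_adjoint,
      ContinuousLinearMap.adjoint_inner_right, hS, orthonormal_iff_ite.1 b.orthonormal]
    split_ifs with h1 h2 h2
    · obtain ⟨rfl, rfl⟩ := Prod.ext_iff.1 (j.injective h1)
      rw [orthonormal_iff_ite.1 b.orthonormal, if_pos rfl]
    · exact absurd (Prod.ext_iff.1 (j.injective h1)).1 h2
    · subst h2
      rw [orthonormal_iff_ite.1 b.orthonormal, if_neg]
      rintro rfl
      exact h1 rfl
    · simp
  refine ⟨S, isCuntzKriegerFamily_ones_iff.2 ⟨b.continuousLinearMap_ext fun y => ?_,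
    fun e => b.continuousLinearMap_ext fun x => ?_⟩⟩
  · obtain ⟨⟨f, x⟩, rfl⟩ := j.surjective y
    rw [sum_apply]
    simp [hstar, hS, apply_ite]
  · simp [hS, hstar]

/-- The Cuntz algebra is nonzero. -/
instance CuntzAlgebra.instNontrivial {ι : Type u} [Fintype ι] [Nonempty ι] :
    Nontrivial (CuntzAlgebra ι) := by
  -- A countably infinite basis splits into copies of itself indexed by ι. The `ULift` puts the
  -- Hilbert space in the universe where `lift` applies.
  obtain ⟨j⟩ : Nonempty (ι × ULift.{u} ℕ ≃ ULift.{u} ℕ) := nonempty_equiv_of_countable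
  let H : Type u := lp (fun _ : ULift.{u} ℕ => ℂ) 2
  let b : HilbertBasis (ULift.{u} ℕ) ℂ H := HilbertBasis.ofRepr (LinearIsometryEquiv.refl ℂ H)
  obtain ⟨S, hS⟩ := b.exists_cuntzFamily j
  have : Nontrivial H := ⟨b ⟨0⟩, 0, b.orthonormal.ne_zero _⟩
  refine ⟨1, 0, fun h => ?_⟩
  have h1 := congrArg (CuntzKriegerAlgebra.lift hS) h
  rw [map_one, map_zero] at h1
  exact one_ne_zero h1

end CuntzRepresentation

/-! ### Words equal to 1 in the Cuntz algebra -/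

theorem CuntzAlgebra.star_gen_mul_gen {ι : Type u} [Fintype ι] (e : ι) :
    star (CuntzAlgebra.gen e) * CuntzAlgebra.gen e = 1 :=
  (isCuntzKriegerFamily_ones_iff.1 CuntzKriegerAlgebra.isCuntzKriegerFamily_gen).2 e

/-- In a Cuntz algebra with at least two generators no generator is right invertible. -/
theorem CuntzAlgebra.gen_mul_ne_one {ι : Type u} [Fintype ι] [Nontrivial ι] (e : ι)
    (a : CuntzAlgebra ι) : CuntzAlgebra.gen e * a ≠ 1 := by
  intro h
  obtain ⟨f, hf⟩ := exists_ne e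
  -- If S_e a = 1, then S_f^* = S_f^* S_e a = 0, against S_f^* S_f = 1 ≠ 0.
  have h1 : star (CuntzAlgebra.gen f) * CuntzAlgebra.gen e = 0 :=
    CuntzKriegerAlgebra.isCuntzKriegerFamily_gen.star_mul_eq_zero hf
  have h2 : star (CuntzAlgebra.gen (ι := ι) f) = 0 := by
    rw [← mul_one (star (CuntzAlgebra.gen f)), ← h, ← mul_assoc, h1, zero_mul]
  have h3 := CuntzAlgebra.star_gen_mul_gen f
  rw [h2, zero_mul] at h3
  have : Nonempty ι := ⟨f⟩
  exact zero_ne_one h3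

/-- A first letter of μ would be right invertible; for ν the same applies after taking adjoints. -/
theorem CuntzAlgebra.eq_nil_of_prod_mul_star_prod_eq_one {ι : Type u} [Fintype ι] [Nontrivial ι]
    {μ ν : List ι}
    (h : (μ.map CuntzAlgebra.gen).prod * star (ν.map CuntzAlgebra.gen).prod = 1) :
    μ = [] ∧ ν = [] := by
  cases μ with
  | cons e μ =>
    rw [List.map_cons, List.prod_cons, mul_assoc] at h
    exact absurd h (CuntzAlgebra.gen_mul_ne_one e _)
  | nil =>
    cases ν with
    | nil => exact ⟨rfl, rfl⟩
    | cons e ν =>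
      have h1 := congrArg star h
      rw [List.map_nil, List.prod_nil, one_mul, star_star, star_one, List.map_cons,
        List.prod_cons] at h1
      exact absurd h1 (CuntzAlgebra.gen_mul_ne_one e _)

theorem wordProd_eq_list_prod {ι B : Type*} [CStarAlgebra B] (S : ι → B) {m : ℕ}
    (X : Fin m → ι ⊕ ι) :
    wordProd S X = ((List.ofFn X).map (Sum.elim (fun e => star (S e)) S)).prod := by
  rw [wordProd, List.map_ofFn]
  rfl

/-! ### Vertex projections and normal forms -/

namespace EdgeGraph

variable {V : Type*} {E : Type u} [DecidableEq V] [Fintype E] (G : EdgeGraph V E)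

theorem isCuntzKriegerFamily_S : IsCuntzKriegerFamily (G.edgeMatrix ℕ) G.S :=
  CuntzKriegerAlgebra.isCuntzKriegerFamily_gen

theorem star_S_mul_S (e : E) : star (G.S e) * G.S e = G.P (G.tgt e) := by
  rw [G.isCuntzKriegerFamily_S.source_eq, P, Finset.sum_filter]
  refine Finset.sum_congr rfl fun f _ => ?_
  simp only [edgeMatrix, Matrix.of_apply, ite_smul, one_smul, zero_smul, eq_comm]

theorem star_P (v : V) : star (G.P v) = G.P v := by
  simp [P, star_sum]

theorem P_mul_S (v : V) (e : E) : G.P v * G.S e = if G.src e = v then G.S e else 0 := by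
  classical
  have h : ∀ f, G.S f * star (G.S f) * G.S e = if f = e then G.S e else 0 := fun f => by
    split_ifs with hf
    · rw [hf, G.isCuntzKriegerFamily_S.partialIsometry]
    · rw [mul_assoc, G.isCuntzKriegerFamily_S.star_mul_eq_zero hf, mul_zero]
  rw [P, Finset.sum_mul]
  simp only [h, Finset.sum_ite_eq', Finset.mem_filter, Finset.mem_univ, true_and]

theorem star_S_mul_P (e : E) (v : V) :
    star (G.S e) * G.P v = if G.src e = v then star (G.S e) else 0 := by
  have h := congrArg star (G.P_mul_S v e)
  rwa [star_mul, star_P, apply_ite star, star_zero] at h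

theorem P_mul_P (v w : V) : G.P v * G.P w = if v = w then G.P v else 0 := by
  have h : ∀ f, G.P v * (G.S f * star (G.S f)) = if G.src f = v then G.S f * star (G.S f) else 0 :=
    fun f => by rw [← mul_assoc, P_mul_S, ite_mul, zero_mul]
  conv_lhs => rw [P.eq_def G w]
  rw [Finset.mul_sum]
  simp only [h]
  split_ifs with hvw
  · rw [hvw, P]
    exact Finset.sum_congr rfl fun f hf => if_pos (Finset.mem_filter.1 hf).2
  · refine Finset.sum_eq_zero fun f hf => if_neg ?_
    rw [(Finset.mem_filter.1 hf).2]
    exact Ne.symm hvw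

theorem sum_P [Fintype V] : ∑ v, G.P v = 1 := by
  simp only [P]
  rw [Finset.sum_fiberwise, G.isCuntzKriegerFamily_S.sum_range]

theorem S_mul_P_tgt (e : E) : G.S e * G.P (G.tgt e) = G.S e := by
  rw [← star_S_mul_S, ← mul_assoc, G.isCuntzKriegerFamily_S.partialIsometry]

theorem P_tgt_mul_star_S (e : E) : G.P (G.tgt e) * star (G.S e) = star (G.S e) := by
  rw [← star_S_mul_S, G.isCuntzKriegerFamily_S.star_mul_self_mul_star]

/-- A nonempty word whose product does not vanish in the Cuntz algebra reduces to the same normal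
form there and in the Cuntz--Krieger algebra, up to a vertex projection in the middle. -/
theorem exists_normalForm (w : List (E ⊕ E)) (hw : w ≠ [])
    (h0 : (w.map (Sum.elim (fun e => star (CuntzAlgebra.gen e)) CuntzAlgebra.gen)).prod ≠ 0) :
    ∃ μ ν : List E,
      (w.map (Sum.elim (fun e => star (CuntzAlgebra.gen e)) CuntzAlgebra.gen)).prod =
        (μ.map CuntzAlgebra.gen).prod * star (ν.map CuntzAlgebra.gen).prod ∧
      ((w.map (Sum.elim (fun e => star (G.S e)) G.S)).prod = 0 ∨
        ∃ v, (w.map (Sum.elim (fun e => star (G.S e)) G.S)).prod =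
          (μ.map G.S).prod * (G.P v * star (ν.map G.S).prod)) := by
  induction w with
  | nil => exact absurd rfl hw
  -- Letters are prepended one at a time. The induction starts at length one because the empty
  -- product is 1, in general not a single vertex projection.
  | cons x w ih =>
    rw [List.map_cons, List.prod_cons] at h0
    simp only [List.map_cons, List.prod_cons]
    rcases eq_or_ne w [] with rfl | hw'
    · rcases x with e | e
      · exact ⟨[], [e], by simp, .inr ⟨G.tgt e, by simp [P_tgt_mul_star_S]⟩⟩
      · exact ⟨[e], [], by simp, .inr ⟨G.tgt e, by simp [S_mul_P_tgt]⟩⟩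
    obtain ⟨μ, ν, hO, hG⟩ := ih hw' (right_ne_zero_of_mul h0)
    rcases x with e | e
    · rw [hO] at h0 ⊢
      cases μ with
      | nil =>
        -- The adjoint reverses order, so S_e^* S_ν^* is the adjoint of the product over ν ++ [e].
        -- Here S_e^* P_v is either 0 or S_e^* = P_{t(e)} S_e^*, which supplies the new middle
        -- projection.
        refine ⟨[], ν ++ [e], by simp, ?_⟩
        rcases hG with hG | ⟨v, hG⟩
        · exact .inl (by rw [hG, mul_zero])
        rw [hG]
        by_cases hv : G.src e = v
        · refine .inr ⟨G.tgt e, ?_⟩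
          simp [← mul_assoc, star_S_mul_P, hv, P_tgt_mul_star_S]
        · refine .inl ?_
          simp [← mul_assoc, star_S_mul_P, hv]
      | cons f μ =>
        -- Distinct letters would make the Cuntz product vanish. After cancellation, the leftover
        -- P_{t(f)} is absorbed by the next letter of μ or by the middle projection, or it
        -- annihilates the product.
        have hfe : f = e := by
          by_contra hne
          apply h0
          simp only [Sum.elim_inl, List.map_cons, List.prod_cons, ← mul_assoc]
          rw [CuntzKriegerAlgebra.isCuntzKriegerFamily_gen.star_mul_eq_zero (Ne.symm hne)]
          simp
        subst hfe
        refine ⟨μ, ν, ?_, ?_⟩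
        · simp only [Sum.elim_inl, List.map_cons, List.prod_cons, ← mul_assoc]
          rw [CuntzAlgebra.star_gen_mul_gen, one_mul]
        rcases hG with hG | ⟨v, hG⟩
        · exact .inl (by rw [hG, mul_zero])
        rw [hG]
        simp only [Sum.elim_inl, List.map_cons, List.prod_cons, ← mul_assoc, star_S_mul_S]
        cases μ with
        | nil =>
          by_cases hv : G.tgt f = v
          · exact .inr ⟨v, by simp [P_mul_P, hv]⟩
          · exact .inl (by simp [P_mul_P, hv])
        | cons g μ =>
          simp only [List.map_cons, List.prod_cons, ← mul_assoc, P_mul_S]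
          by_cases hv : G.src g = G.tgt f
          · exact .inr ⟨v, by simp [hv]⟩
          · exact .inl (by simp [hv])
    · refine ⟨e :: μ, ν, by simp [hO, mul_assoc], ?_⟩
      rcases hG with hG | ⟨v, hG⟩
      · exact .inl (by rw [hG, mul_zero])
      · exact .inr ⟨v, by simp [hG, mul_assoc]⟩

/-- Every nonempty Catalan word is rooted at a vertex. -/
theorem exists_wordProd_eq_P [Fintype V] [Nonempty E] (hin : ∀ v, ∃ e, G.tgt e = v) {n : ℕ} (hn : n ≠ 0)
    {X : Fin (2 * n) → E ⊕ E} (hX : X ∈ G.catalanWords n) : ∃ v, wordProd G.S X = G.P v := by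
  obtain ⟨hG, hO⟩ : wordProd G.S X ≠ 0 ∧ wordProd CuntzAlgebra.gen X = 1 := by
    simpa [catalanWords] using hX
  -- With one edge the Cuntz generator is unitary, so S_μ S_ν^* = 1 does not force μ and ν empty.
  -- But then there is one vertex, its projection is 1, and the two algebras coincide.
  rcases subsingleton_or_nontrivial E with hE | hE
  · obtain ⟨e⟩ := ‹Nonempty E›
    have hV : ∀ v, v = G.src e := fun v => by
      obtain ⟨f, rfl⟩ := hin v
      obtain ⟨g, hg⟩ := hin (G.src e)
      rw [← hg, Subsingleton.elim f g]
    have hA : G.edgeMatrix ℕ = Matrix.of fun _ _ => 1 := by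
      ext f g
      rw [edgeMatrix, Matrix.of_apply, Matrix.of_apply, if_pos]
      rw [hV (G.tgt f), hV (G.src g)]
    -- The matrix occurs in the type of the algebra, so the statement is generalized over it before
    -- the equality is substituted.
    have h1 : ∀ A : Matrix E E ℕ, A = Matrix.of (fun _ _ => 1) →
        wordProd (CuntzKriegerAlgebra.gen A) X = 1 := by
      rintro _ rfl
      exact hO
    refine ⟨G.src e, (h1 _ hA).trans ?_⟩
    rw [← G.sum_P, Fintype.sum_eq_single (G.src e) fun v hv => absurd (hV v) hv]
  · rw [wordProd_eq_list_prod] at hG hO ⊢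
    obtain ⟨μ, ν, h1, h2⟩ := G.exists_normalForm (List.ofFn X)
      (by simpa [List.ofFn_eq_nil_iff] using hn)
      (by rw [hO]; exact one_ne_zero)
    obtain ⟨rfl, rfl⟩ := CuntzAlgebra.eq_nil_of_prod_mul_star_prod_eq_one (h1.symm.trans hO)
    obtain ⟨v, hv⟩ := h2.resolve_left hG
    exact ⟨v, by simpa using hv⟩

/-! ### Values of a KMS state on the projections -/

section KMS

variable {G} {β : ℝ} {φ : G.CKAlgebra →ₗ[ℂ] ℂ}

theorem isEntireExtension_gaugeFlow_S (e : E) :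
    IsEntireExtension G.gaugeFlow (G.S e) fun z => Complex.exp (z * Complex.I) • G.S e where
  differentiable := by fun_prop
  apply_real t := by
    rw [gaugeFlow, S, CuntzKriegerAlgebra.gauge_gen, Circle.coe_exp]

/-- Use b = S_e^* at t = 0: the entire extension of the orbit of S_e at iβ has the factor exp(i ·
iβ) = e^{-β}. -/
theorem _root_.IsKMSState.apply_S_mul_star_S (hφ : IsKMSState G.gaugeFlow β φ) (e : E) :
    φ (G.S e * star (G.S e)) = (Real.exp (-β) : ℂ) * φ (G.P (G.tgt e)) := by
  have h := hφ.kms _ (star (G.S e)) _ (isEntireExtension_gaugeFlow_S e) 0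
  have h0 : G.gaugeFlow 0 (G.S e) = G.S e := by
    rw [gaugeFlow, S, CuntzKriegerAlgebra.gauge_gen, Circle.exp_zero, Circle.coe_one, one_smul]
  have h1 : ((0 : ℝ) + β * Complex.I) * Complex.I = ((-β : ℝ) : ℂ) := by
    rw [Complex.ofReal_zero, zero_add, mul_assoc, Complex.I_mul_I]
    push_cast
    ring
  rw [h0] at h
  rw [h, h1, mul_smul_comm, map_smul, star_S_mul_S, smul_eq_mul, Complex.ofReal_exp]

/-- A KMS state for the gauge flow takes the entries of the Perron--Frobenius eigenvector as values
on the range projections. -/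
theorem _root_.IsKMSState.apply_S_mul_star_S_eq [DecidableEq E] (hφ : IsKMSState G.gaugeFlow β φ)
    (haper : (G.edgeMatrix ℝ).IsPrimitive) {t : E → ℝ} {r : ℝ} (ht_pos : ∀ e, 0 < t e)
    (ht_eigen : (G.edgeMatrix ℝ).mulVec t = r • t) (ht_sum : ∑ e, t e = 1) (e : E) :
    φ (G.S e * star (G.S e)) = t e := by
  let x : E → ℝ := fun e => (φ (G.S e * star (G.S e))).re
  have hx : ∀ e, φ (G.S e * star (G.S e)) = x e := fun e => by
    have h := (hφ.isState.nonneg (star (G.S e))).2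
    rw [star_star] at h
    exact Complex.ext rfl (by rw [h, Complex.ofReal_im])
  have hx0 : ∀ e, 0 ≤ x e := fun e => by
    simpa using (hφ.isState.nonneg (star (G.S e))).1
  have hx1 : ∑ e, x e = 1 := by
    have h := congrArg φ G.isCuntzKriegerFamily_S.sum_range
    rw [map_sum, hφ.isState.map_one] at h
    simp only [hx] at h
    exact_mod_cast h
  -- Expanding P_{t(e)} into range projections turns the KMS relation into an eigenvector equation.
  -- No relation between e^β and r is needed beforehand.
  have hxA : (G.edgeMatrix ℝ).mulVec x = Real.exp β • x := by
    funext e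
    have h := hφ.apply_S_mul_star_S e
    rw [hx, P, map_sum] at h
    simp only [hx] at h
    have h' : x e = Real.exp (-β) * ∑ f with G.src f = G.tgt e, x f := by exact_mod_cast h
    rw [Pi.smul_apply, smul_eq_mul, h', ← mul_assoc, ← Real.exp_add, add_neg_cancel, Real.exp_zero,
      one_mul, Finset.sum_filter]
    simp only [Matrix.mulVec, dotProduct, edgeMatrix, Matrix.of_apply, ite_mul, one_mul, zero_mul,
      eq_comm]
  rw [hx, haper.eq_of_nonneg_eigenvector ht_pos hx0 ht_eigen hxA ht_sum hx1]

/-- The value is the coordinate (A t)_e, as P_{t(e)} sums the range projections of the edges that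
can follow e. -/
theorem _root_.IsKMSState.apply_P_tgt [DecidableEq E] (hφ : IsKMSState G.gaugeFlow β φ)
    (haper : (G.edgeMatrix ℝ).IsPrimitive) {t : E → ℝ} {r : ℝ} (ht_pos : ∀ e, 0 < t e)
    (ht_eigen : (G.edgeMatrix ℝ).mulVec t = r • t) (ht_sum : ∑ e, t e = 1) (e : E) :
    φ (G.P (G.tgt e)) = r * t e := by
  have h := congrFun ht_eigen e
  rw [Pi.smul_apply, smul_eq_mul] at h
  rw [P, map_sum]
  simp only [hφ.apply_S_mul_star_S_eq haper ht_pos ht_eigen ht_sum]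
  rw [← Complex.ofReal_mul, ← h, ← Complex.ofReal_sum, Finset.sum_filter]
  simp only [Matrix.mulVec, dotProduct, edgeMatrix, Matrix.of_apply, ite_mul, one_mul, zero_mul,
    eq_comm]

end KMS

/-! ### Counting words by root -/

theorem stateCatalanNumberAt_eq (φ : G.CKAlgebra →ₗ[ℂ] ℂ) (n : ℕ) (v : V) :
    G.stateCatalanNumberAt φ n v = G.catalanNumberAt n v * φ (G.P v) := by
  classical
  rw [stateCatalanNumberAt, catalanNumberAt]
  split_ifs with hn
  · simp
  · rw [Finset.sum_congr rfl fun X hX => by rw [(Finset.mem_filter.1 hX).2], Finset.sum_const,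
      nsmul_eq_mul]

/-- For n = 0 this is ∑ P v = 1; for n > 0 the Catalan words are partitioned by their roots. -/
theorem stateCatalanNumber_eq_sum [Fintype V] [Nonempty E] (hin : ∀ v, ∃ e, G.tgt e = v)
    {φ : G.CKAlgebra →ₗ[ℂ] ℂ} (hφ : φ 1 = 1) (n : ℕ) :
    G.stateCatalanNumber φ n = ∑ v, G.stateCatalanNumberAt φ n v := by
  classical
  unfold stateCatalanNumber stateCatalanNumberAt
  split_ifs with hn
  · rw [← map_sum, sum_P, hφ]
  · have hU : G.catalanWords n = Finset.univ.biUnion fun v => G.catalanWordsAt n v := by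
      ext X
      simp only [Finset.mem_biUnion, Finset.mem_univ, true_and, catalanWordsAt, Finset.mem_filter]
      exact ⟨fun h => (G.exists_wordProd_eq_P hin hn h).imp fun v hv => ⟨h, hv⟩, fun ⟨_, h, _⟩ => h⟩
    rw [hU, Finset.sum_biUnion]
    intro v _ w _ hvw
    refine Finset.disjoint_left.2 fun X hv hw => ?_
    obtain ⟨hX, hv⟩ := Finset.mem_filter.1 hv
    have hw := (Finset.mem_filter.1 hw).2
    have h0 : wordProd G.S X ≠ 0 := (Finset.mem_filter.1 hX).2.1
    apply h0
    -- A word with two distinct roots would have product P v = P v * P w = 0, but Catalan words have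
    -- nonzero product.
    have h := G.P_mul_P v w
    rw [← hw, hv, P_mul_P, if_pos rfl, if_neg hvw] at h
    rw [hv, h]

end EdgeGraph

theorem proposition9p3 {V : Type*} {E : Type*} [Fintype V] [DecidableEq V] [Fintype E]
    [DecidableEq E] (G : EdgeGraph V E)
    (hout : ∀ v, ∃ e, G.src e = v) (hin : ∀ v, ∃ e, G.tgt e = v)
    (haper : (G.edgeMatrix ℝ).IsPrimitive)
    (β : ℝ) (φ : G.CKAlgebra →ₗ[ℂ] ℂ) (hφ : IsKMSState G.gaugeFlow β φ)
    (t : E → ℝ) (ht_pos : ∀ e, 0 < t e)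
    (ht_eigen : (G.edgeMatrix ℝ).mulVec t = G.perronEigenvalue • t)
    (ht_sum : ∑ e, t e = 1)
    (ε : V → E) (hε : ∀ v, G.tgt (ε v) = v) :
    (∀ n v, G.stateCatalanNumberAt φ n v =
      (G.perronEigenvalue : ℂ) * (G.catalanNumberAt n v : ℂ) * (t (ε v) : ℂ)) ∧
    (∀ n, G.stateCatalanNumber φ n =
      (G.perronEigenvalue : ℂ) * ∑ v, (G.catalanNumberAt n v : ℂ) * (t (ε v) : ℂ)) ∧
    (∀ v, G.stateGenFunAt φ v =
      PowerSeries.C (G.perronEigenvalue : ℂ) * G.genFunAt v * PowerSeries.C (t (ε v) : ℂ)) ∧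
    G.stateGenFun φ =
      PowerSeries.C (G.perronEigenvalue : ℂ) *
        ∑ v, G.genFunAt v * PowerSeries.C (t (ε v) : ℂ) := by
  have hE : Nonempty E := by
    by_contra h
    rw [not_nonempty_iff] at h
    simp at ht_sum
  -- Any edge ending at v computes φ(P v), so the choice of `ε` is immaterial.
  have hP : ∀ v, φ (G.P v) = G.perronEigenvalue * t (ε v) := fun v => by
    have h := hφ.apply_P_tgt haper ht_pos ht_eigen ht_sum (ε v)
    rwa [hε] at h
  have h1 : ∀ n v, G.stateCatalanNumberAt φ n v =
      (G.perronEigenvalue : ℂ) * (G.catalanNumberAt n v : ℂ) * (t (ε v) : ℂ) := fun n v => by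
    rw [G.stateCatalanNumberAt_eq, hP]
    ring
  have h2 : ∀ n, G.stateCatalanNumber φ n =
      (G.perronEigenvalue : ℂ) * ∑ v, (G.catalanNumberAt n v : ℂ) * (t (ε v) : ℂ) := fun n => by
    rw [G.stateCatalanNumber_eq_sum hin hφ.isState.map_one, Finset.mul_sum]
    exact Finset.sum_congr rfl fun v _ => by rw [h1, mul_assoc]
  refine ⟨h1, h2, fun v => ?_, ?_⟩
  · ext n
    rw [PowerSeries.coeff_mul_C, PowerSeries.coeff_C_mul]
    simp only [EdgeGraph.stateGenFunAt, EdgeGraph.genFunAt, PowerSeries.coeff_mk, h1]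
  · ext n
    rw [PowerSeries.coeff_C_mul, map_sum]
    simp only [PowerSeries.coeff_mul_C, EdgeGraph.stateGenFun, EdgeGraph.genFunAt,
      PowerSeries.coeff_mk, h2]
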